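/- Let $p, r \in \{2, 3, 4, \dots\} \cup \{\infty\}$. Let $\mathrm{Diff}_c^r(\mathbb{R})$ denote the group of compactly supported, orientation-preserving $C^r$-diffeomorphisms of $\mathbb{R}$ (these are automatically isotopic to the identity), and for a group $G$ of diffeomorphisms of $\mathbb{R}$ let $\mathrm{Fix}(G) = \{x \in \mathbb{R} : g(x) = x \text{ for all } g \in G\}$. A group homomorphism $\Phi : \mathrm{Diff}_c^r(\mathbb{R}) \to \mathrm{Diff}_c^p(\mathbb{R})$ is called topologically diagonal if there is a finite or countably infinite collection of topological embeddings $f_i : \mathbb{R} \to \mathbb{R}$, whose images are pairwise disjoint and all contained in one compact subset of $\mathbb{R}$, such that for every $g \in \mathrm{Diff}_c^r(\mathbb{R})$ $$\Phi(g)(x) = \begin{cases} f_i g f_i^{-1}(x) & \text{if } x \in f_i(\mathbb{R}), \\ x & \text{if } x \notin \bigcup_i f_i(\mathbb{R}). \end{cases}$$ If $\Phi : \mathrm{Diff}_c^r(\mathbb{R}) \to \mathrm{Diff}_c^p(\mathbb{R})$ is topologically diagonal, then $\mathbb{R} \setminus \mathrm{Fix}\,\Phi(\mathrm{Diff}_c^r(\mathbb{R}))$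 has only finitely many connected components. -/

import Mathlib

/-- The group `Diff_c^r(ℝ)` of compactly supported, orientation-preserving `C^r`-diffeomorphisms of
the line, `r ∈ ℕ ∪ {∞}`, with composition as multiplication. On the line the further requirement
of being isotopic to the identity is automatic (for `r ≥ 1`): see `DiffC.isotopic_id`. -/
def DiffC (r : ℕ∞) : Subgroup (Equiv.Perm ℝ) where
  carrier := {g | ContDiff ℝ r g ∧ ContDiff ℝ r g.symm ∧ StrictMono g ∧
    IsCompact (closure {x | g x ≠ x})}
  one_mem' := by
    refine ⟨contDiff_id, contDiff_id, strictMono_id, ?_⟩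
    simp
  mul_mem' := by
    rintro a b ⟨ha, ha', ham, hac⟩ ⟨hb, hb', hbm, hbc⟩
    refine ⟨ha.comp hb, hb'.comp ha', ham.comp hbm, (hac.union hbc).of_isClosed_subset
      isClosed_closure (closure_minimal (fun x hx => ?_) (isClosed_closure.union isClosed_closure))⟩
    by_cases h : b x = x
    · refine Or.inl (subset_closure ?_)
      simpa [h] using hx
    · exact Or.inr (subset_closure h)
  inv_mem' := by
    rintro a ⟨ha, ha', ham, hac⟩
    refine ⟨ha', ha, fun x y hxy => ?_, ?_⟩
    · by_contra hcon
      have h : a (a.symm y) ≤ a (a.symm x) := ham.monotone (not_lt.mp hcon)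
      rw [Equiv.apply_symm_apply, Equiv.apply_symm_apply] at h
      exact absurd hxy (not_lt.mpr h)
    · have h : {x | a⁻¹ x ≠ x} = {x | a x ≠ x} := by
        ext x
        simp only [Set.mem_ofPred_eq, ne_eq, Equiv.Perm.inv_eq_iff_eq]
        exact not_congr eq_comm
      rw [h]
      exact hac

/-- Every element of `DiffC r`, `r ≥ 1`, is isotopic to the identity through elements of `DiffC r`
supported in a common compact set, by an isotopy that is jointly `C^r`. -/
theorem DiffC.isotopic_id {r : ℕ∞} (hr : 1 ≤ r) (g : DiffC r) :
    ∃ (H : ℝ × ℝ → ℝ) (K : Set ℝ), ContDiff ℝ r H ∧ IsCompact K ∧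
      (∀ x, H (0, x) = x) ∧ (∀ x, H (1, x) = (g : Equiv.Perm ℝ) x) ∧
      ∀ t ∈ Set.Icc (0 : ℝ) 1, ∃ h ∈ DiffC r, (∀ x, h x = H (t, x)) ∧ ∀ x ∉ K, h x = x := by
  obtain ⟨g, hg, hg', hm, hc⟩ := g
  have hr' : ((r : ℕ∞) : WithTop ℕ∞) ≠ 0 := by
    intro h
    have h0 : r = 0 := by exact_mod_cast h
    simp [h0] at hr
  have hd : Differentiable ℝ g := hg.differentiable hr'
  have hd' : Differentiable ℝ g.symm := hg'.differentiable hr'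
  have hpos : ∀ x, 0 < deriv g x := by
    intro x
    refine lt_of_le_of_ne hm.monotone.deriv_nonneg fun h0 => ?_
    have h1 : HasDerivAt (g.symm ∘ g) (deriv g.symm (g x) * deriv g x) x :=
      (hd' (g x)).hasDerivAt.comp x (hd x).hasDerivAt
    have h2 : (g.symm ∘ g : ℝ → ℝ) = id := by ext y; simp
    rw [h2, ← h0, mul_zero] at h1
    exact zero_ne_one (h1.unique (hasDerivAt_id x))
  refine ⟨fun q => (1 - q.1) * q.2 + q.1 * g q.2, closure {x | g x ≠ x}, ?_, hc, by simp, by simp,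
    ?_⟩
  · exact ((contDiff_const.sub contDiff_fst).mul contDiff_snd).add
      (contDiff_fst.mul (hg.comp contDiff_snd))
  rintro t ⟨ht0, ht1⟩
  set F : ℝ → ℝ := fun x => (1 - t) * x + t * g x with hF
  have hFs : ContDiff ℝ r F := (contDiff_const.mul contDiff_id).add (contDiff_const.mul hg)
  have hFd : ∀ x, HasDerivAt F ((1 - t) * 1 + t * deriv g x) x := fun x =>
    ((hasDerivAt_id x).const_mul (1 - t)).add ((hd x).hasDerivAt.const_mul t)
  have hFp : ∀ x, 0 < (1 - t) * 1 + t * deriv g x := by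
    intro x
    rcases eq_or_lt_of_le ht0 with h | h
    · simp [← h]
    · have := mul_pos h (hpos x)
      linarith
  have hFm : StrictMono F := strictMono_of_deriv_pos fun x => by
    rw [(hFd x).deriv]; exact hFp x
  have hout : ∀ x ∉ closure {x | g x ≠ x}, F x = x := by
    intro x hx
    have : g x = x := by
      by_contra h
      exact hx (subset_closure h)
    simp only [hF, this]; ring
  have hFsurj : Function.Surjective F := by
    obtain ⟨M, hM⟩ := hc.isBounded.exists_norm_le
    refine hFs.continuous.surjective ?_ ?_
    · refine Filter.tendsto_id.congr' ?_
      filter_upwards [Filter.eventually_gt_atTop M] with x hx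
      refine (hout x fun h => ?_).symm
      exact absurd ((le_abs_self x).trans (hM x h)) (not_le.mpr hx)
    · refine Filter.tendsto_id.congr' ?_
      filter_upwards [Filter.eventually_lt_atBot (-M)] with x hx
      refine (hout x fun h => ?_).symm
      have h3 := (neg_le_abs x).trans (hM x h)
      linarith
  let o : ℝ ≃o ℝ := hFm.orderIsoOfSurjective F hFsurj
  refine ⟨o.toEquiv, ⟨hFs, ?_, hFm, ?_⟩, fun x => rfl, fun x hx => hout x hx⟩
  · exact o.toHomeomorph.contDiff_symm_deriv (fun x => (hFp x).ne') hFd hFs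
  · refine hc.of_isClosed_subset isClosed_closure (closure_minimal (fun x hx => ?_) isClosed_closure)
    by_contra h
    exact hx (hout x h)

/-- `Φ : Diff_c^r(ℝ) → Diff_c^p(ℝ)` is topologically diagonal: there is a finite or countably
infinite family of topological embeddings `f i : ℝ → ℝ` with pairwise disjoint images, all contained
in one compact set, such that `Φ g` is `f i ∘ g ∘ (f i)⁻¹` on the image of each `f i` and is the
identity off the union of the images. -/
def IsTopologicallyDiagonal {r p : ℕ∞} (Φ : DiffC r →* DiffC p) : Prop :=
  ∃ (ι : Type) (_ : Countable ι) (f : ι → ℝ → ℝ),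
    (∀ i, Topology.IsEmbedding (f i)) ∧
    (∀ i j, i ≠ j → Disjoint (Set.range (f i)) (Set.range (f j))) ∧
    (∃ K : Set ℝ, IsCompact K ∧ ∀ i, Set.range (f i) ⊆ K) ∧
    ∀ g : DiffC r,
      (∀ i y, (Φ g : Equiv.Perm ℝ) (f i y) = f i ((g : Equiv.Perm ℝ) y)) ∧
      ∀ x, (∀ i, x ∉ Set.range (f i)) → (Φ g : Equiv.Perm ℝ) x = x

/-- `Fix(G)`, the set of points of the line fixed by every element of the subgroup `G`. -/
def fixSet {p : ℕ∞} (G : Subgroup (DiffC p)) : Set ℝ :=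
  {x | ∀ g ∈ G, (g : Equiv.Perm ℝ) x = x}

/-! The non-fixed set is the union of the connected images of the `f i`, so it suffices that there
are finitely many indices. Take `g` fixing `0` with multiplier `m ≠ 1`. Each `f i 0` is then a fixed
point of `Φ g`, and these points are distinct and lie in one compact set. If their multipliers under
`Φ g` are all `m`, they cannot accumulate: at a limit point the derivative of `Φ g` would be `m` by
continuity, but `1` by difference quotients.

The multiplier survives conjugation only if `f i` is differentiable at `0` with nonzero derivative.
Being monotone, `f i` is differentiable somewhere by Lebesgue's theorem; equivariance and
transitivity of `DiffC r` carry this to every point. -/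

open Filter Topology in
/-- A smooth compactly supported perturbation of the identity with derivative `> -1` is a
diffeomorphism. -/
theorem DiffC.exists_of_perturbation (r : ℕ∞) {u : ℝ → ℝ} (hu : ContDiff ℝ (⊤ : ℕ∞) u)
    (hc : HasCompactSupport u) (hlt : ∀ x, -1 < deriv u x) :
    ∃ g : DiffC r, ∀ x, (g : Equiv.Perm ℝ) x = x + u x := by
  have hus : ContDiff ℝ r u := hu.of_le (by exact_mod_cast le_top)
  have hud : Differentiable ℝ u := hu.differentiable (by simp)
  set F : ℝ → ℝ := fun x => x + u x with hF
  have hFs : ContDiff ℝ r F := contDiff_id.add hus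
  have hFd : ∀ x, HasDerivAt F (1 + deriv u x) x := fun x =>
    (hasDerivAt_id x).add (hud x).hasDerivAt
  have hFp : ∀ x, 0 < 1 + deriv u x := fun x => by linarith [hlt x]
  have hFm : StrictMono F := strictMono_of_deriv_pos fun x => by
    rw [(hFd x).deriv]; exact hFp x
  obtain ⟨M, hM⟩ := hc.isBounded.exists_norm_le
  have hout : ∀ x, M < |x| → F x = x := fun x hx => by
    have : u x = 0 := image_eq_zero_of_notMem_tsupport fun h => absurd (hM x h) (not_le.mpr hx)
    simp [hF, this]
  have hFsurj : Function.Surjective F := by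
    refine hFs.continuous.surjective ?_ ?_
    · refine tendsto_id.congr' ?_
      filter_upwards [eventually_gt_atTop M] with x hx
      exact (hout x (hx.trans_le (le_abs_self x))).symm
    · refine tendsto_id.congr' ?_
      filter_upwards [eventually_lt_atBot (-M)] with x hx
      exact (hout x (by linarith [neg_le_abs x])).symm
  let o : ℝ ≃o ℝ := hFm.orderIsoOfSurjective F hFsurj
  refine ⟨⟨o.toEquiv, hFs, ?_, hFm, ?_⟩, fun x => rfl⟩
  · exact o.toHomeomorph.contDiff_symm_deriv (fun x => (hFp x).ne') hFd hFs
  · refine hc.isCompact.of_isClosed_subset isClosed_closure (closure_mono fun x hx => ?_)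
    intro h
    refine hx ?_
    change x + u x = x
    rw [h, add_zero]

theorem exists_abs_deriv_le_of_hasCompactSupport {v : ℝ → ℝ} (hv : ContDiff ℝ (⊤ : ℕ∞) v)
    (hc : HasCompactSupport v) : ∃ C, 0 < C ∧ ∀ x, |deriv v x| ≤ C := by
  obtain ⟨C, hC⟩ := hc.deriv.exists_bound_of_continuous (hv.continuous_deriv (by simp))
  exact ⟨max C 1, by positivity, fun x => (hC x).trans (le_max_left _ _)⟩

/-- `DiffC r` acts transitively on the line. -/
theorem DiffC.exists_apply_eq (r : ℕ∞) (a b : ℝ) : ∃ g : DiffC r, (g : Equiv.Perm ℝ) a = b := by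
  let φ : ContDiffBump (0 : ℝ) := ⟨1, 2, one_pos, one_lt_two⟩
  obtain ⟨C, hC0, hC⟩ := exists_abs_deriv_le_of_hasCompactSupport (v := φ)
    φ.contDiff φ.hasCompactSupport
  have hden : 0 < C * |b - a| + 1 := by positivity
  -- Stretching the bump horizontally by `1 / k` brings the slope of the displacement down to at
  -- most `C * |b - a| * k < 1`, while its height at `a` remains `b - a`.
  set k : ℝ := (C * |b - a| + 1)⁻¹ with hk
  have hk0 : 0 < k := inv_pos.mpr hden
  set A : ℝ ≃ₜ ℝ := (Homeomorph.subRight a).trans (Homeomorph.mulLeft₀ k hk0.ne') with hA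
  have hAx : ∀ x, A x = k * (x - a) := fun x => rfl
  have hd : ∀ x, HasDerivAt (fun x => (b - a) * φ (A x)) ((b - a) * (deriv φ (A x) * k)) x := by
    intro x
    have h1 : HasDerivAt A k x := by
      have h := ((hasDerivAt_id x).sub_const a).const_mul k
      rwa [mul_one] at h
    have h2 : HasDerivAt φ (deriv φ (A x)) (A x) :=
      (φ.contDiff.differentiable (n := 1) (by simp) _).hasDerivAt
    exact (h2.comp x h1).const_mul (b - a)
  have hs : ContDiff ℝ (⊤ : ℕ∞) fun x => (b - a) * φ (A x) :=
    contDiff_const.mul (φ.contDiff.comp (contDiff_const.mul (contDiff_id.sub contDiff_const)))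
  have hlt : ∀ x, -1 < deriv (fun x => (b - a) * φ (A x)) x := by
    intro x
    rw [(hd x).deriv]
    have h : |(b - a) * (deriv φ (A x) * k)| < 1 := by
      rw [abs_mul, abs_mul, abs_of_pos hk0, ← mul_assoc, hk, ← div_eq_mul_inv, div_lt_one hden]
      nlinarith [mul_le_mul_of_nonneg_left (hC (A x)) (abs_nonneg (b - a))]
    exact (abs_lt.mp h).1
  obtain ⟨g, hg⟩ := DiffC.exists_of_perturbation r hs
    (φ.hasCompactSupport.comp_homeomorph A).mul_left hlt
  refine ⟨g, ?_⟩
  have : φ (A a) = 1 := φ.one_of_mem_closedBall (by simp [hAx, φ])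
  rw [hg, this]
  ring

/-- There is an element of `DiffC r` with a fixed point at `0` whose multiplier is not `1`. -/
theorem DiffC.exists_hasDerivAt_ne_one (r : ℕ∞) :
    ∃ (g : DiffC r) (m : ℝ), (g : Equiv.Perm ℝ) 0 = 0 ∧ m ≠ 1 ∧
      HasDerivAt (g : Equiv.Perm ℝ) m 0 := by
  let φ : ContDiffBump (0 : ℝ) := ⟨1, 2, one_pos, one_lt_two⟩
  -- Near `0` this function is `x` itself; dividing by `C + 1` keeps the slope above `-1` and gives
  -- the multiplier `1 + 1 / (C + 1)`.
  have hvs : ContDiff ℝ (⊤ : ℕ∞) (fun x : ℝ => x * φ x) := contDiff_id.mul φ.contDiff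
  have hvc : HasCompactSupport (fun x : ℝ => x * φ x) := φ.hasCompactSupport.mul_left
  obtain ⟨C, hC0, hC⟩ := exists_abs_deriv_le_of_hasCompactSupport hvs hvc
  have hden : 0 < C + 1 := by positivity
  have hd : ∀ x, HasDerivAt (fun x : ℝ => (C + 1)⁻¹ * (x * φ x))
      ((C + 1)⁻¹ * deriv (fun x : ℝ => x * φ x) x) x := fun x =>
    (hvs.differentiable (by simp) x).hasDerivAt.const_mul _
  have h0 : deriv (fun x : ℝ => x * φ x) 0 = 1 := by
    have h2 : HasDerivAt φ (deriv φ 0) 0 :=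
      (φ.contDiff.differentiable (n := 1) (by simp) _).hasDerivAt
    have h3 : φ 0 = 1 := φ.one_of_mem_closedBall (by simp [φ])
    have h4 := ((hasDerivAt_id (0 : ℝ)).mul h2).deriv
    rw [h3, id_eq, zero_mul, add_zero, mul_one] at h4
    exact h4
  have hlt : ∀ x, -1 < deriv (fun x : ℝ => (C + 1)⁻¹ * (x * φ x)) x := by
    intro x
    rw [(hd x).deriv]
    have h : |(C + 1)⁻¹ * deriv (fun x : ℝ => x * φ x) x| < 1 := by
      rw [abs_mul, abs_of_pos (inv_pos.mpr hden), mul_comm, ← div_eq_mul_inv, div_lt_one hden]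
      linarith [hC x]
    exact (abs_lt.mp h).1
  obtain ⟨g, hg⟩ := DiffC.exists_of_perturbation r (contDiff_const.mul hvs) hvc.mul_left hlt
  refine ⟨g, 1 + (C + 1)⁻¹, by simp [hg], by simpa using hden.ne', ?_⟩
  have h := (hasDerivAt_id (0 : ℝ)).add (hd 0)
  rw [h0, mul_one] at h
  exact h.congr_of_eventuallyEq (Filter.Eventually.of_forall hg)

/-- A continuous injective function on the line is differentiable somewhere. -/
theorem Continuous.exists_differentiableAt_of_injective {f : ℝ → ℝ} (hf : Continuous f)
    (hi : Function.Injective f) : ∃ x, DifferentiableAt ℝ f x := by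
  rcases hf.strictMono_of_inj hi with h | h
  · exact h.monotone.ae_differentiableAt.exists
  · obtain ⟨x, hx⟩ := h.antitone.neg.ae_differentiableAt.exists
    exact ⟨x, by simpa using hx.neg⟩

/-- A topological embedding of the line that conjugates every element of `DiffC r` into a
differentiable map has a nonzero derivative at every point. -/
theorem exists_hasDerivAt_ne_zero_of_conj {r : ℕ∞} {f : ℝ → ℝ} (hf : Topology.IsEmbedding f)
    (Ψ : DiffC r → ℝ → ℝ) (hΨ : ∀ g, Differentiable ℝ (Ψ g)) (hr : r ≠ 0)
    (hconj : ∀ g y, Ψ g (f y) = f ((g : Equiv.Perm ℝ) y)) (y : ℝ) :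
    ∃ d, d ≠ 0 ∧ HasDerivAt f d y := by
  -- With `g a = b`, write `f = Ψ g ∘ f ∘ g⁻¹` near `b`. The chain rule moves differentiability from
  -- `a` to `b` and leaves `deriv f a` as a factor.
  have key : ∀ a b, DifferentiableAt ℝ f a →
      ∃ c e : ℝ, HasDerivAt f (c * (deriv f a * e)) b := by
    intro a b ha
    obtain ⟨g, hg⟩ := DiffC.exists_apply_eq r a b
    have hg' : (g : Equiv.Perm ℝ).symm b = a := by rw [← hg, Equiv.symm_apply_apply]
    have h1 : HasDerivAt (g : Equiv.Perm ℝ).symm (deriv (g : Equiv.Perm ℝ).symm b) b :=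
      (g.2.2.1.differentiable (by exact_mod_cast hr) b).hasDerivAt
    have h2 : HasDerivAt f (deriv f a) ((g : Equiv.Perm ℝ).symm b) := by
      rw [hg']; exact ha.hasDerivAt
    have h3 := ((hΨ g) (f ((g : Equiv.Perm ℝ).symm b))).hasDerivAt.comp b (h2.comp b h1)
    refine ⟨_, _, h3.congr_of_eventuallyEq (Filter.Eventually.of_forall fun x => ?_)⟩
    simp [hconj]
  obtain ⟨a, ha⟩ := hf.continuous.exists_differentiableAt_of_injective hf.injective
  obtain ⟨c, e, hb⟩ := key a y ha
  refine ⟨deriv f y, fun h0 => ?_, hb.differentiableAt.hasDerivAt⟩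
  -- A zero of the derivative at `y` would spread to the whole line through that factor, making `f`
  -- constant.
  have hz : ∀ x, HasDerivAt f 0 x := fun x => by
    obtain ⟨c', e', hx⟩ := key y x hb.differentiableAt
    simpa [h0] using hx
  have := is_const_of_deriv_eq_zero (fun x => (hz x).differentiableAt) (fun x => (hz x).deriv) 0 1
  exact zero_ne_one (hf.injective this)

open Filter Topology in
/-- The fixed points of a `C¹` function at which the derivative has a given value `m ≠ 1` do not
accumulate. -/
theorem finite_of_fixed_of_deriv_eq {h : ℝ → ℝ} (hh : ContDiff ℝ 1 h) {m : ℝ} (hm : m ≠ 1)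
    {s K : Set ℝ} (hK : IsCompact K) (hsK : s ⊆ K) (hfix : ∀ x ∈ s, h x = x)
    (hder : ∀ x ∈ s, deriv h x = m) : s.Finite := by
  by_contra hs
  obtain ⟨x, -, hx⟩ := Set.Infinite.exists_accPt_of_subset_isCompact hs hK hsK
  have hne : (𝓝[≠] x ⊓ 𝓟 s).NeBot := hx
  have hle : 𝓝[≠] x ⊓ 𝓟 s ≤ 𝓝 x := inf_le_left.trans nhdsWithin_le_nhds
  have hev : ∀ᶠ y in 𝓝[≠] x ⊓ 𝓟 s, y ∈ s := mem_inf_of_right (mem_principal_self s)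
  have hev' : ∀ᶠ y in 𝓝[≠] x ⊓ 𝓟 s, y ≠ x := mem_inf_of_left self_mem_nhdsWithin
  have hxfix : h x = x := by
    refine tendsto_nhds_unique (l := 𝓝[≠] x ⊓ 𝓟 s) ((hh.continuous.tendsto x).mono_left hle) ?_
    exact (tendsto_id.mono_left hle).congr' (hev.mono fun y hy => (hfix y hy).symm)
  have hxm : deriv h x = m := by
    refine tendsto_nhds_unique (l := 𝓝[≠] x ⊓ 𝓟 s) (((hh.continuous_deriv le_rfl).tendsto x).mono_left hle) ?_
    exact tendsto_const_nhds.congr' (hev.mono fun y hy => (hder y hy).symm)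
  -- The slope of `h` between two distinct fixed points is exactly `1`.
  have hx1 : deriv h x = 1 := by
    have hsl := (hasDerivAt_iff_tendsto_slope.mp (hh.differentiable one_ne_zero x).hasDerivAt)
    refine tendsto_nhds_unique (l := 𝓝[≠] x ⊓ 𝓟 s) (hsl.mono_left inf_le_left) ?_
    refine tendsto_const_nhds.congr' ?_
    filter_upwards [hev, hev'] with y hy hyx
    rw [slope_def_field, hfix y hy, hxfix, div_self (sub_ne_zero.mpr hyx)]
  exact hm (hxm.symm.trans hx1)

theorem proposition4p4 (r p : ℕ∞) (hr : 2 ≤ r) (hp : 2 ≤ p) (Φ : DiffC r →* DiffC p)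
    (hΦ : IsTopologicallyDiagonal Φ) :
    Finite (ConnectedComponents ((fixSet Φ.range)ᶜ : Set ℝ)) := by
  obtain ⟨ι, -, f, hemb, hdisj, ⟨K, hK, hfK⟩, hconj⟩ := hΦ
  have hr0 : r ≠ 0 := (lt_of_lt_of_le two_pos hr).ne'
  have hp1 : ((1 : ℕ∞) : WithTop ℕ∞) ≤ (p : WithTop ℕ∞) :=
    WithTop.coe_le_coe.mpr (one_le_two.trans hp)
  have hC1 : ∀ g, ContDiff ℝ 1 (Φ g : Equiv.Perm ℝ) := fun g => (Φ g).2.1.of_le hp1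
  have hfin : Finite ι := by
    obtain ⟨g, m, hg0, hm, hgd⟩ := DiffC.exists_hasDerivAt_ne_one r
    have hinj : Function.Injective fun i => f i 0 := fun i j hij => by
      by_contra hne
      exact Set.disjoint_left.mp (hdisj i j hne) ⟨0, rfl⟩ ⟨0, hij.symm⟩
    have hfixed : ∀ i, (Φ g : Equiv.Perm ℝ) (f i 0) = f i 0 := fun i => by
      rw [(hconj g).1, hg0]
    refine Set.finite_range_iff hinj |>.mp <| finite_of_fixed_of_deriv_eq (hC1 g) hm hK ?_ ?_ ?_
    · rintro _ ⟨i, rfl⟩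
      exact hfK i ⟨0, rfl⟩
    · rintro _ ⟨i, rfl⟩
      exact hfixed i
    · rintro _ ⟨i, rfl⟩
      obtain ⟨d, hd0, hd⟩ := exists_hasDerivAt_ne_zero_of_conj (hemb i)
        (fun g => (Φ g : Equiv.Perm ℝ)) (fun g => (hC1 g).differentiable one_ne_zero) hr0
        (fun g y => (hconj g).1 i y) 0
      have hleft : HasDerivAt (fun y => (Φ g : Equiv.Perm ℝ) (f i y))
          (deriv (Φ g : Equiv.Perm ℝ) (f i 0) * d) 0 :=
        ((hC1 g).differentiable one_ne_zero (f i 0)).hasDerivAt.comp 0 hd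
      have hright : HasDerivAt (fun y => f i ((g : Equiv.Perm ℝ) y)) (d * m) 0 :=
        HasDerivAt.comp 0 (by rw [hg0]; exact hd) hgd
      -- Both sides of `Φ g ∘ f i = f i ∘ g` are differentiated at `0`; cancelling `d ≠ 0` leaves
      -- `m`.
      rw [funext fun y => (hconj g).1 i y] at hleft
      exact mul_right_cancel₀ hd0 ((hleft.unique hright).trans (mul_comm d m))
  have hmem : ∀ i y, f i y ∈ (fixSet Φ.range)ᶜ := fun i y hfix => by
    obtain ⟨g, hg⟩ := DiffC.exists_apply_eq r y (y + 1)
    have h := hfix (Φ g) ⟨g, rfl⟩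
    rw [(hconj g).1, hg] at h
    linarith [(hemb i).injective h]
  -- Every component contains some `f i 0`, because a non-fixed point lies in some connected image
  -- `f i (ℝ)`.
  refine Finite.of_surjective
    (fun i : ι => ConnectedComponents.mk (⟨f i 0, hmem i 0⟩ : ((fixSet Φ.range)ᶜ : Set ℝ))) ?_
  intro c
  obtain ⟨⟨x, hx⟩, rfl⟩ := ConnectedComponents.surjective_coe c
  obtain ⟨i, y, rfl⟩ : ∃ i, x ∈ Set.range (f i) := by
    by_contra! hno
    refine hx ?_
    rintro _ ⟨g, rfl⟩
    exact (hconj g).2 x hno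
  refine ⟨i, ConnectedComponents.coe_eq_coe'.mpr ?_⟩
  have hcont : Continuous fun z => (⟨f i z, hmem i z⟩ : ((fixSet Φ.range)ᶜ : Set ℝ)) :=
    (hemb i).continuous.subtype_mk _
  exact (isPreconnected_range hcont).subset_connectedComponent ⟨y, rfl⟩ ⟨0, rfl⟩
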